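/- Let $n,k\ge 0$ be integers, $V=[n]$, and let $(k+1)^V$ be the set of all tuples $\boldsymbol x=(X_1,\dots,X_k)$ of pairwise disjoint subsets of $V$. A function $f:(k+1)^V\to\mathbb R$ is $k$-submodular if $f(\boldsymbol x)+f(\boldsymbol y)\ge f(\boldsymbol x\sqcup\boldsymbol y)+f(\boldsymbol x\sqcap\boldsymbol y)$ for all $\boldsymbol x,\boldsymbol y$, where $\boldsymbol x\sqcap\boldsymbol y$ has the parts $X_i\cap Y_i$ and $\boldsymbol x\sqcup\boldsymbol y$ has the parts $(X_i\cup Y_i)\setminus\bigcup_{j\ne i}(X_j\cup Y_j)$. It is monotone if every marginal gain $\Delta_{e,i}f(\boldsymbol x)=f(X_1,\dots,X_i\cup\{e\},\dots,X_k)-f(\boldsymbol x)$ with $e\notin\bigcup_\ell X_\ell$ and $i\in[k]$ is nonnegative. Given integers $B_1,\dots,B_k\ge 0$ (individual size constraints), let $B=\sum_i B_i$; $\boldsymbol x$ is feasible if $|X_i|\le B_i$ for all $i$. Stochastic bandit. Let $f_1,f_2,\dots$ be i.i.d. random functions on $(k+1)^V$ with values in $[0,1]$ almost surely, and let $f(\boldsymbol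 x)=\mathbb E[f_t(\boldsymbol x)]$; assume that $f$ is monotone and $k$-submodular. In each round $t=1,\dots,T$ the learner plays an action $A_t\in(k+1)^V$, which depends only on the rewards received in the earlier rounds, and receives (and observes only) the reward $f_t(A_t)$. With $\mathrm{OPT}$ a maximizer of $f$ over the feasible $\boldsymbol x$, the expected cumulative $\tfrac13$-regret is $$\mathbb E[\mathcal R_T]=\tfrac13\,T f(\mathrm{OPT})-\mathbb E\Big[\sum_{t=1}^T f_t(A_t)\Big].$$ Greedy algorithm (with a value oracle $\hat f$). Start with $\boldsymbol s=(\emptyset,\dots,\emptyset)$. In each of $B$ rounds, query the value of $\boldsymbol s$ with $e$ added to its $i$-th part for every available pair $(e,i)$, that is, every pair with $e\in V$ not yet in $\boldsymbol s$ and fewer than $B_i$ elements of type $i$ in $\boldsymbol s$, and add a pair with the largest value, equivalently with the largest marginal gain $\Delta_{e,i}\hat f(\boldsymbol s)$; if no pair is available, stop. Return $\boldsymbol s$. The order of the queries is any fixed order of the pairs, and ties are broken by any fixed rule that depends only on $\boldsymbol s$ and on the set of maximizing pairs. C-ETC with the greedy algorithm. Put $\delta=\tfrac43(B+1)$, $N=nkB$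 and $m=\Big\lceil \frac{\delta^{2/3}T^{2/3}\log(T)^{1/3}}{2N^{2/3}}\Big\rceil$. Run the greedy algorithm; whenever it queries the value of an action $A$, play $A$ for $m$ rounds and return the empirical mean of the observed rewards as the answer. When the greedy algorithm has returned $\boldsymbol s$, play $\boldsymbol s$ in all remaining rounds. The procedure ends after $T$ rounds in any case. (If $N=0$ there are no queries and $m$ is irrelevant.) Claim. There is an absolute constant $C>0$ such that for all $n$, $k$, $B_1,\dots,B_k$, all such reward distributions, all query orders and tie-breaking rules, and all integers $T\ge 0$ with $$T\ge nk\max\Big\{1,\frac{3\sqrt2\,B}{2(B+1)}\Big\},$$ the cumulative reward of C-ETC with the greedy algorithm is integrable and its expected cumulative $\tfrac13$-regret satisfies $$\mathbb E[\mathcal R_T]\le C\,n^{1/3}k^{1/3}\,B\,T^{2/3}\log(T)^{1/3}$$ (with the convention $\log 0=0$ for $T=0$). -/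

import Mathlib

open MeasureTheory ProbabilityTheory

/-! ### The lattice-like set `(k+1)^V` with `V = [n]`, and `k`-submodular functions -/

/-- An element of `(k+1)^V` with `V = [n]`: every element `e` receives either a type `i`
(`x e = some i`) or no type (`x e = none`). It is the tuple `(X₁, …, X_k)` of pairwise disjoint
subsets `X_i = {e | x e = some i}`. -/
abbrev KAssign (n k : ℕ) : Type := Fin n → Option (Fin k)

namespace KAssign

variable {n k : ℕ}

/-- The `i`-th part `X_i = supp_i(x)`. -/
def part (x : KAssign n k) (i : Fin k) : Finset (Fin n) :=
  Finset.univ.filter (fun e => x e = some i)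

/-- The empty solution `(∅, …, ∅)`. -/
def empty : KAssign n k := fun _ => none

/-- Assign the type `i` to the element `e`. -/
def assign (x : KAssign n k) (e : Fin n) (i : Fin k) : KAssign n k :=
  Function.update x e (some i)

/-- `x ⊓ y`; its `i`-th part is `X_i ∩ Y_i`, see `mem_part_meet`. -/
def meet (x y : KAssign n k) : KAssign n k :=
  fun e => if x e = y e then x e else none

/-- `x ⊔ y`; its `i`-th part is `(X_i ∪ Y_i) \ ⋃_{j ≠ i} (X_j ∪ Y_j)`, see `mem_part_join`. -/
def join (x y : KAssign n k) : KAssign n k :=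
  fun e => if x e = none then y e
    else if y e = none then x e
    else if x e = y e then x e else none

theorem mem_part_meet (x y : KAssign n k) (i : Fin k) (e : Fin n) :
    e ∈ (meet x y).part i ↔ e ∈ x.part i ∧ e ∈ y.part i := by
  simp only [part, meet, Finset.mem_filter, Finset.mem_univ, true_and]
  grind

theorem mem_part_join (x y : KAssign n k) (i : Fin k) (e : Fin n) :
    e ∈ (join x y).part i ↔ (e ∈ x.part i ∨ e ∈ y.part i) ∧
      ∀ j, j ≠ i → ¬ (e ∈ x.part j ∨ e ∈ y.part j) := by
  simp only [part, join, Finset.mem_filter, Finset.mem_univ, true_and]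
  cases hx : x e <;> cases hy : y e <;> simp <;> grind

/-- `k`-submodularity: `f x + f y ≥ f (x ⊔ y) + f (x ⊓ y)` for all `x`, `y`. -/
def IsKSubmodular (f : KAssign n k → ℝ) : Prop :=
  ∀ x y, f (join x y) + f (meet x y) ≤ f x + f y

/-- The marginal gain `Δ_{e,i} f(x)`, meant for `e` without a type in `x`. -/
def marginal (f : KAssign n k → ℝ) (x : KAssign n k) (e : Fin n) (i : Fin k) : ℝ :=
  f (x.assign e i) - f x

/-- Monotonicity: all marginal gains are nonnegative. -/
def IsMonotone (f : KAssign n k → ℝ) : Prop :=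
  ∀ x e i, x e = none → 0 ≤ marginal f x e i

/-- The individual size constraints: at most `b i` elements have type `i`. -/
def Feasible (b : Fin k → ℕ) (x : KAssign n k) : Prop :=
  ∀ i, (x.part i).card ≤ b i

/-- The pairs `(e, i)` with `e ∉ supp(s)` and `|supp_i(s)| < b i`. -/
def available (b : Fin k → ℕ) (s : KAssign n k) : Finset (Fin n × Fin k) :=
  Finset.univ.filter (fun p => s p.1 = none ∧ (s.part p.2).card < b p.2)

end KAssign

/-! ### Offline algorithms with a value oracle -/

/-- A (deterministic) offline algorithm with access to a value oracle over the actions `A`: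
it either stops with an output, or queries the value of an action and continues depending on
the answer. -/
inductive OracleAlg (A : Type) : Type
  | ret (a : A) : OracleAlg A
  | query (a : A) (cont : ℝ → OracleAlg A) : OracleAlg A

namespace OracleAlg

/-- Query the values of the actions `act p` for `p` in a list, one after the other, store the
answers in the table `v`, and continue with the completed table. -/
def queryAll {A P : Type} [DecidableEq P] (act : P → A) :
    List P → (P → ℝ) → ((P → ℝ) → OracleAlg A) → OracleAlg A
  | [], v, cont => cont v
  | p :: ps, v, cont =>
      query (act p) (fun r => queryAll act ps (Function.update v p r) cont)

end OracleAlg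

/-- The set of maximizers of `v` over the finite set `S`. -/
noncomputable def argmaxSet {P : Type} (S : Finset P) (v : P → ℝ) : Finset P :=
  open Classical in S.filter (fun p => ∀ q ∈ S, v q ≤ v p)

theorem argmaxSet_nonempty {P : Type} {S : Finset P} (hS : S.Nonempty) (v : P → ℝ) :
    (argmaxSet S v).Nonempty := by
  obtain ⟨p, hp, h⟩ := Finset.exists_max_image S v hS
  exact ⟨p, by classical simp only [argmaxSet, Finset.mem_filter]; exact ⟨hp, h⟩⟩

/-- The choices that the greedy algorithm leaves open: the order in which the values of the
item-type pairs are queried, and the way in which ties between maximizers are broken. -/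
structure GreedyRule (n k : ℕ) where
  order : List (Fin n × Fin k)
  nodup : order.Nodup
  complete : ∀ p, p ∈ order
  tie : KAssign n k → (S : Finset (Fin n × Fin k)) → S.Nonempty → Fin n × Fin k
  tie_mem : ∀ s S hS, tie s S hS ∈ S

/-- `j` further rounds of the greedy algorithm from the current solution `s`. In each round the
values of all solutions `s + (e, i)` with `(e, i)` available are queried, and a pair with the
largest one is added. As `f s` is the same for all pairs, this is a pair of largest marginal gain
`f (s + (e, i)) - f s`, and the value of `s` itself need not be queried. If no pair is available
(which within the first `∑ i, b i` rounds happens only if all elements have a type), the algorithm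
stops. -/
noncomputable def greedyLoop {n k : ℕ} (rule : GreedyRule n k) (b : Fin k → ℕ) :
    ℕ → KAssign n k → OracleAlg (KAssign n k)
  | 0, s => .ret s
  | j + 1, s =>
      if h : (s.available b).Nonempty then
        OracleAlg.queryAll (fun p : Fin n × Fin k => s.assign p.1 p.2)
          (rule.order.filter (fun p => p ∈ s.available b)) (fun _ => 0)
          (fun v =>
            let p := rule.tie s (argmaxSet (s.available b) v) (argmaxSet_nonempty h v)
            greedyLoop rule b j (s.assign p.1 p.2))
      else .ret s

/-- The greedy algorithm under individual size constraints `b`. -/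
noncomputable def greedyIS {n k : ℕ} (rule : GreedyRule n k) (b : Fin k → ℕ) :
    OracleAlg (KAssign n k) :=
  greedyLoop rule b (∑ i, b i) KAssign.empty

/-! ### Bandit learning -/

/-- A learner with full-bandit feedback: the next action as a function of the list of the rewards
received so far, in chronological order. -/
abbrev BanditPolicy (A : Type) : Type := List ℝ → A

/-- The list of rewards that the policy `π` has received before round `t`, the rounds being
numbered from `0`, if the reward functions are `F 0, F 1, …`. -/
def rewardHistory {A : Type} (π : BanditPolicy A) (F : ℕ → A → ℝ) : ℕ → List ℝ
  | 0 => []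
  | t + 1 => rewardHistory π F t ++ [F t (π (rewardHistory π F t))]

/-- The action that the policy `π` plays in round `t`. -/
def playedAction {A : Type} (π : BanditPolicy A) (F : ℕ → A → ℝ) (t : ℕ) : A :=
  π (rewardHistory π F t)

/-- The cumulative reward of the rounds `0, …, T - 1`. -/
def cumulativeReward {A : Type} (π : BanditPolicy A) (F : ℕ → A → ℝ) (T : ℕ) : ℝ :=
  ∑ t ∈ Finset.range T, F t (playedAction π F t)

/-- Explore-then-commit with an offline algorithm as subroutine: whenever the algorithm queries
the value of `a`, play `a` for `m` rounds and return the empirical mean of the rewards; once the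
algorithm has stopped with output `a`, play `a` forever. -/
noncomputable def exploreThenCommit {A : Type} (m : ℕ) : OracleAlg A → BanditPolicy A
  | .ret a, _ => a
  | .query a cont, h =>
      if h.length < m then a
      else exploreThenCommit m (cont ((h.take m).sum / m)) (h.drop m)

/-- The number `m = ⌈δ^{2/3} T^{2/3} log(T)^{1/3} / (2 N^{2/3})⌉` of repetitions in C-ETC. -/
noncomputable def cetcReps (δ N : ℝ) (T : ℕ) : ℕ :=
  ⌈δ ^ (2 / 3 : ℝ) * (T : ℝ) ^ (2 / 3 : ℝ) * Real.log T ^ (1 / 3 : ℝ) /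
    (2 * N ^ (2 / 3 : ℝ))⌉₊

/-- C-ETC with horizon `T`, the offline algorithm `alg`, and the parameters `δ` and `N`. -/
noncomputable def cetc {A : Type} (δ N : ℝ) (T : ℕ) (alg : OracleAlg A) : BanditPolicy A :=
  exploreThenCommit (cetcReps δ N T) alg

/-- C-ETC with the greedy algorithm for individual size constraints as subroutine, where
`δ = (4/3)(B + 1)`, `N = n k B` and `B = ∑ i, b i`. -/
noncomputable def cetcGreedyIS {n k : ℕ} (rule : GreedyRule n k) (b : Fin k → ℕ) (T : ℕ) :
    BanditPolicy (KAssign n k) :=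
  cetc (4 / 3 * (((∑ i, b i : ℕ) : ℝ) + 1)) ((n : ℝ) * k * (∑ i, b i : ℕ)) T (greedyIS rule b)

/-- The random reward functions `F 0, F 1, …` are i.i.d. with values in `[0, 1]`. -/
structure IsRewardProcess {Ω A : Type*} [MeasurableSpace Ω] (μ : Measure Ω)
    (F : ℕ → Ω → A → ℝ) : Prop where
  measurable : ∀ t, Measurable (F t)
  indep : iIndepFun F μ
  identDistrib : ∀ t, IdentDistrib (F t) (F 0) μ μ
  bounded : ∀ t a, ∀ᵐ ω ∂μ, F t ω a ∈ Set.Icc (0 : ℝ) 1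

/-- The expected reward function `f(a) = E[f_t(a)]`, which does not depend on `t`. -/
noncomputable def expectedReward {Ω A : Type*} [MeasurableSpace Ω] (μ : Measure Ω)
    (F : ℕ → Ω → A → ℝ) (a : A) : ℝ :=
  ∫ ω, F 0 ω a ∂μ

/-- The expected cumulative `α`-regret of the policy `π` with respect to the optimal action `opt`:
`α T f(opt) - E[∑_t f_t(A_t)]`. -/
noncomputable def expectedRegret {Ω : Type*} {A : Type} [MeasurableSpace Ω] (μ : Measure Ω)
    (F : ℕ → Ω → A → ℝ) (α : ℝ) (π : BanditPolicy A) (T : ℕ) (opt : A) : ℝ :=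
  α * T * expectedReward μ F opt - ∫ ω, cumulativeReward π (fun t => F t ω) T ∂μ

/-! ### The greedy algorithm with an inexact value oracle -/

/-! The offline part is an exchange argument. Alongside the greedy solution `s`, keep a feasible `o`
that extends `s`, starting from the optimum. When greedy adds `(e, i)`, `o` may have to give up a
different type of `e` and one element of a full part `i`. By orthant submodularity each removal
costs at most the marginal gain over `s` of the removed pair. That pair was available, so its gain
exceeds the greedy gain by at most `2 * ε` if answers are `ε`-accurate. Adding `(e, i)` to `o` costs
nothing by monotonicity. Hence `o` loses at most twice the greedy gain plus `4 * ε`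
(`KAssign.exists_exchange`). The two solutions finally coincide, and telescoping gives value at
least `f o / 3 - (4/3) * ε * B` (`greedyIS_achieves`).

The online part needs accurate means only for the actions actually played in the `N = n * k * B`
possible query blocks. The action of a block is determined by earlier rewards and so is independent
of the rewards in the block. Hoeffding's inequality therefore applies conditionally on the action,
and the union bound runs over `N` blocks instead of all actions
(`IsRewardProcess.measure_blockMean_playedAction_le`). The regret is at most the `N * m` exploration
rounds, plus `T` times the failure probability, plus `(4/3) * T * ε * B`. The accuracy `ε` occurs
only in the analysis; taking it of order `(n * k * log T / T) ^ (1/3)` balances the terms. -/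

namespace KAssign

variable {n k : ℕ}

/-- The order on partial assignments: `o` extends `s`. -/
def Extends (o s : KAssign n k) : Prop := ∀ e, s e ≠ none → o e = s e

/-- Remove the type of `e`. -/
def erase (x : KAssign n k) (e : Fin n) : KAssign n k := Function.update x e none

theorem mem_part {x : KAssign n k} {i : Fin k} {e : Fin n} : e ∈ x.part i ↔ x e = some i := by
  simp [part]

theorem Extends.part_subset {o s : KAssign n k} (h : Extends o s) (i : Fin k) :
    s.part i ⊆ o.part i := by
  intro e he
  rw [mem_part] at he ⊢
  rw [h e (by simp [he]), he]

/-- Orthant submodularity. -/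
theorem IsKSubmodular.marginal_le {f : KAssign n k → ℝ} (hf : IsKSubmodular f)
    {o s : KAssign n k} (h : Extends o s) {e : Fin n} (he : o e = none) (i : Fin k) :
    marginal f o e i ≤ marginal f s e i := by
  have hs : s e = none := by
    by_contra hne
    exact hne ((h e hne).symm.trans he)
  -- Apply `k`-submodularity to `o` and `s + (e, i)`: the join is `o + (e, i)` and the meet is `s`.
  have h1 : join o (s.assign e i) = o.assign e i := by
    funext d
    by_cases hd : d = e
    · subst hd; simp [join, assign, he]
    · have := h d
      simp only [join, assign, Function.update_of_ne hd]
      grind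
  have h2 : meet o (s.assign e i) = s := by
    funext d
    by_cases hd : d = e
    · subst hd; simp [meet, assign, he, hs]
    · have := h d
      simp only [meet, assign, Function.update_of_ne hd]
      grind
  have := hf o (s.assign e i)
  rw [h1, h2] at this
  unfold marginal
  linarith

theorem assign_erase {o : KAssign n k} {e : Fin n} {i : Fin k} (h : o e = some i) :
    (o.erase e).assign e i = o := by
  simp [assign, erase, ← h]

/-- The loss is the marginal gain of `(e, i)` over `o.erase e`, which still extends `s`; orthant
submodularity compares it with the gain over `s`. -/
theorem IsKSubmodular.sub_erase_le {f : KAssign n k → ℝ} (hf : IsKSubmodular f)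
    {o s : KAssign n k} (h : Extends o s) {e : Fin n} {i : Fin k} (he : o e = some i)
    (hs : s e = none) : f o - f (o.erase e) ≤ marginal f s e i := by
  have h' : Extends (o.erase e) s := by
    intro d hd
    have hde : d ≠ e := by rintro rfl; exact hd hs
    simpa [erase, hde] using h d hd
  have := hf.marginal_le h' (e := e) (by simp [erase]) i
  rwa [marginal, assign_erase he] at this

theorem IsMonotone.le_assign {f : KAssign n k → ℝ} (hf : IsMonotone f) {x : KAssign n k}
    {e : Fin n} (he : x e = none) (i : Fin k) : f x ≤ f (x.assign e i) :=
  sub_nonneg.1 (hf x e i he)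

theorem mem_available {b : Fin k → ℕ} {s : KAssign n k} {p : Fin n × Fin k} :
    p ∈ s.available b ↔ s p.1 = none ∧ (s.part p.2).card < b p.2 := by
  simp [available]

/-- As `e` is missing from `s`, the `i`-th part of `s` is strictly smaller than that of `o`, which
respects the budget. This lets greedy gains bound the gains of pairs removed from `o`. -/
theorem Extends.mem_available {b : Fin k → ℕ} {o s : KAssign n k} (h : Extends o s)
    (ho : Feasible b o) {e : Fin n} {i : Fin k} (he : o e = some i) (hs : s e = none) :
    (e, i) ∈ s.available b := by
  refine KAssign.mem_available.2 ⟨hs, lt_of_lt_of_le (Finset.card_lt_card ?_) (ho i)⟩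
  refine Finset.ssubset_iff_subset_ne.2 ⟨h.part_subset i, fun heq => ?_⟩
  have : e ∈ s.part i := heq ▸ mem_part.2 he
  rw [mem_part, hs] at this
  cases this

/-- If nothing is available in `s`, then `s` has no proper feasible extension. -/
theorem Extends.eq_of_available_eq_empty {b : Fin k → ℕ} {o s : KAssign n k} (h : Extends o s)
    (ho : Feasible b o) (hs : ¬ (s.available b).Nonempty) : o = s := by
  funext e
  by_cases he : s e = none
  · cases hoe : o e with
    | none => exact he.symm
    | some i => exact absurd ⟨_, h.mem_available ho hoe he⟩ hs
  · exact h e he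

theorem card_part_assign_same (s : KAssign n k) {e : Fin n} (i : Fin k) (he : s e = none) :
    ((s.assign e i).part i).card = (s.part i).card + 1 := by
  have : (s.assign e i).part i = insert e (s.part i) := by
    ext d
    simp only [mem_part, assign, Finset.mem_insert, Function.update_apply]
    grind
  rw [this, Finset.card_insert_of_notMem (by simp [mem_part, he])]

theorem part_assign_of_ne (s : KAssign n k) {e : Fin n} {i j : Fin k} (hij : j ≠ i)
    (he : s e = none) : (s.assign e i).part j = s.part j := by
  ext d
  simp only [mem_part, assign, Function.update_apply]
  grind

theorem Feasible.assign {b : Fin k → ℕ} {x : KAssign n k} (hx : Feasible b x) {e : Fin n}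
    {i : Fin k} (he : x e = none) (hi : (x.part i).card < b i) : Feasible b (x.assign e i) := by
  intro j
  by_cases hj : j = i
  · subst hj; rw [card_part_assign_same x j he]; exact hi
  · rw [part_assign_of_ne x hj he]; exact hx j

theorem part_erase (x : KAssign n k) (e : Fin n) (i : Fin k) :
    (x.erase e).part i = (x.part i).erase e := by
  ext d
  simp only [mem_part, erase, Function.update_apply, Finset.mem_erase]
  grind

theorem Feasible.erase {b : Fin k → ℕ} {x : KAssign n k} (hx : Feasible b x) (e : Fin n) :
    Feasible b (x.erase e) := by
  intro i
  rw [part_erase]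
  exact (Finset.card_erase_le).trans (hx i)

theorem Feasible.card_part_erase_lt {b : Fin k → ℕ} {x : KAssign n k} (hx : Feasible b x)
    {e : Fin n} {i : Fin k} (he : x e = some i) : ((x.erase e).part i).card < b i := by
  rw [part_erase]
  exact (Finset.card_erase_lt_of_mem (mem_part.2 he)).trans_le (hx i)

/-- The exchange step: if `o` is feasible and extends `s`, and `(e, i)` is an available pair whose
marginal gain is maximal up to `2 ε`, then some feasible `o'` extends `s + (e, i)` and loses at
most twice the gain of this step. -/
theorem exists_exchange {f : KAssign n k → ℝ} (hf : IsKSubmodular f) (hm : IsMonotone f)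
    {b : Fin k → ℕ} {o s : KAssign n k} (h : Extends o s) (ho : Feasible b o) {ε : ℝ} (hε : 0 ≤ ε)
    {e : Fin n} {i : Fin k} (hav : (e, i) ∈ s.available b)
    (hmax : ∀ d j, (d, j) ∈ s.available b → marginal f s d j ≤ marginal f s e i + 2 * ε) :
    ∃ o', Extends o' (s.assign e i) ∧ Feasible b o' ∧
      f o - f o' ≤ 2 * marginal f s e i + 4 * ε := by
  obtain ⟨hse, hsi⟩ := mem_available.1 hav
  have hgain : 0 ≤ marginal f s e i := hm s e i hse
  have key : ∀ {x : KAssign n k}, (∀ d, d ≠ e → s d ≠ none → x d = s d) →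
      Extends (x.assign e i) (s.assign e i) := by
    intro x hx d hd
    by_cases hde : d = e
    · subst hde; simp [assign]
    · simp only [assign, Function.update_of_ne hde] at hd ⊢
      exact hx d hde hd
  by_cases hoe : o e = some i
  · refine ⟨o, ?_, ho, by linarith⟩
    have := key (x := o) (fun d _ => h d)
    have h2 : o.assign e i = o := by simp [assign, ← hoe]
    rwa [h2] at this
  -- remove a conflicting type of `e`, then make room in the part `i`
  have step1 : ∃ o₁, Extends o₁ s ∧ Feasible b o₁ ∧ o₁ e = none ∧
      ((o e = none ∧ o₁ = o) ∨ ∃ i', o e = some i' ∧ o₁ = o.erase e) := by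
    cases hoe' : o e with
    | none => exact ⟨o, h, ho, hoe', .inl ⟨rfl, rfl⟩⟩
    | some i' =>
      refine ⟨o.erase e, ?_, ho.erase e, by simp [erase], .inr ⟨i', rfl, rfl⟩⟩
      intro d hd
      have hde : d ≠ e := by rintro rfl; exact hd hse
      simpa [erase, hde] using h d hd
  obtain ⟨o₁, hext, hfeas, hne, hcase⟩ := step1
  have hloss1 : f o - f o₁ ≤ marginal f s e i + 2 * ε := by
    rcases hcase with ⟨-, rfl⟩ | ⟨i', hi', rfl⟩
    · linarith
    · exact (hf.sub_erase_le h hi' hse).trans (hmax _ _ (h.mem_available ho hi' hse))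
  by_cases hroom : (o₁.part i).card < b i
  · refine ⟨o₁.assign e i, key fun d _ => hext d, hfeas.assign hne hroom, ?_⟩
    have := hm.le_assign hne i
    linarith
  -- Part `i` is full in `o₁` but not in `s`, so it contains some `d` outside `s` that can be
  -- exchanged for `e`.
  · have hlt : (s.part i).card < (o₁.part i).card := by
      simp only at hsi
      omega
    obtain ⟨d, hd, hds⟩ := Finset.exists_mem_notMem_of_card_lt_card hlt
    rw [mem_part] at hd hds
    have hsd : s d = none := by
      by_contra hne'
      exact hds ((hext d hne').symm.trans hd)
    have hde : d ≠ e := by rintro rfl; rw [hne] at hd; cases hd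
    have hne2 : (o₁.erase d) e = none := by simp [erase, hde.symm, hne]
    have hloss2 : f o₁ - f (o₁.erase d) ≤ marginal f s e i + 2 * ε :=
      (hf.sub_erase_le hext hd hsd).trans (hmax _ _ (hext.mem_available hfeas hd hsd))
    have hfeas2 := (hfeas.erase d).assign hne2 (hfeas.card_part_erase_lt hd)
    have hmon := hm.le_assign hne2 i
    have hext2 : Extends ((o₁.erase d).assign e i) (s.assign e i) := by
      refine key fun c _ hsc => ?_
      have hcd : c ≠ d := by rintro rfl; exact hsc hsd
      simpa [erase, hcd] using hext c hsc
    exact ⟨_, hext2, hfeas2, by linarith⟩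

end KAssign

/-! ### Guarantees of oracle algorithms under inexact answers -/

namespace OracleAlg

/-- With an oracle for `f` of accuracy `ε`, the algorithm makes at most `N` queries and returns
an action that satisfies `Q`. -/
inductive Achieves {A : Type} (f : A → ℝ) (ε : ℝ) (Q : A → Prop) : ℕ → OracleAlg A → Prop
  | ret {N : ℕ} {a : A} : Q a → Achieves f ε Q N (.ret a)
  | query {N : ℕ} {a : A} {cont : ℝ → OracleAlg A} :
      (∀ y, |y - f a| ≤ ε → Achieves f ε Q N (cont y)) → Achieves f ε Q (N + 1) (.query a cont)

theorem Achieves.mono {A : Type} {f : A → ℝ} {ε : ℝ} {Q Q' : A → Prop} {N N' : ℕ}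
    {alg : OracleAlg A} (h : Achieves f ε Q N alg) (hN : N ≤ N') (hQ : ∀ a, Q a → Q' a) :
    Achieves f ε Q' N' alg := by
  induction h generalizing N' with
  | ret h => exact .ret (hQ _ h)
  | query _ ih =>
    obtain ⟨M, rfl⟩ : ∃ M, N' = M + 1 := ⟨N' - 1, by omega⟩
    exact .query fun y hy => ih y hy (by omega)

/-- Since `ps` has no duplicates, no answer is overwritten; the clause on entries outside `ps`
carries this through the induction. -/
theorem achieves_queryAll {A P : Type} [DecidableEq P] {f : A → ℝ} {ε : ℝ} {Q : A → Prop}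
    {N : ℕ} {act : P → A} {ps : List P} (hps : ps.Nodup) {v : P → ℝ}
    {cont : (P → ℝ) → OracleAlg A}
    (h : ∀ w, (∀ p ∈ ps, |w p - f (act p)| ≤ ε) → (∀ p, p ∉ ps → w p = v p) →
      Achieves f ε Q N (cont w)) :
    Achieves f ε Q (N + ps.length) (queryAll act ps v cont) := by
  induction ps generalizing v with
  | nil => exact h v (by simp) (by simp)
  | cons p ps ih =>
    obtain ⟨hp, hps⟩ := List.nodup_cons.1 hps
    refine .query fun y hy => ih hps fun w hw hv => h w ?_ ?_
    · intro q hq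
      rcases List.mem_cons.1 hq with rfl | hq
      · rw [hv _ hp]; simpa using hy
      · exact hw q hq
    · intro q hq
      simp only [List.mem_cons, not_or] at hq
      rw [hv _ hq.2, Function.update_of_ne hq.1]

end OracleAlg

/-! ### The approximation guarantee of greedy -/

theorem mem_argmaxSet {P : Type} {S : Finset P} {v : P → ℝ} {p : P} :
    p ∈ argmaxSet S v ↔ p ∈ S ∧ ∀ q ∈ S, v q ≤ v p := by
  simp [argmaxSet]

theorem KAssign.sum_card_part_assign {n k : ℕ} (s : KAssign n k) {e : Fin n} (i : Fin k)
    (he : s e = none) :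
    ∑ j, ((s.assign e i).part j).card = ∑ j, (s.part j).card + 1 := by
  have : ∀ j, ((s.assign e i).part j).card = (s.part j).card + if j = i then 1 else 0 := by
    intro j
    by_cases hj : j = i
    · subst hj; simp [card_part_assign_same s j he]
    · simp [hj, part_assign_of_ne s hj he]
  simp [this, Finset.sum_add_distrib]

/-- The exchange step is telescoped: a loss of `o` is paid for by twice the increase of `f s`. The
hypothesis `hj` says that the remaining rounds suffice to exhaust the budgets. -/
theorem greedyLoop_achieves {n k : ℕ} (rule : GreedyRule n k) (b : Fin k → ℕ)
    {f : KAssign n k → ℝ} (hf : KAssign.IsKSubmodular f) (hm : KAssign.IsMonotone f)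
    {ε : ℝ} (hε : 0 ≤ ε) (j : ℕ) (s o : KAssign n k) (hext : KAssign.Extends o s)
    (ho : KAssign.Feasible b o) (hj : ∑ i, b i ≤ j + ∑ i, (s.part i).card) :
    OracleAlg.Achieves f ε (fun a => f o + 2 * f s ≤ 3 * f a + 4 * ε * j) (j * (n * k))
      (greedyLoop rule b j s) := by
  induction j generalizing s o with
  -- No rounds are left, so `hj` forces every part of `s` to be full; hence nothing is available and
  -- `o = s`.
  | zero =>
    have hle : ∀ i, (s.part i).card ≤ b i := fun i =>
      (Finset.card_le_card (hext.part_subset i)).trans (ho i)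
    have hemp : ¬ (s.available b).Nonempty := by
      rintro ⟨p, hp⟩
      have hlt := (KAssign.mem_available.1 hp).2
      have := Finset.sum_lt_sum (fun i _ => hle i) ⟨p.2, Finset.mem_univ _, hlt⟩
      omega
    have := hext.eq_of_available_eq_empty ho hemp
    subst this
    exact .ret (by simp; linarith)
  | succ j ih =>
    rw [greedyLoop]
    split_ifs with hav
    · have hlen : (rule.order.filter (fun p => p ∈ s.available b)).length ≤ n * k := by
        have hnd := rule.nodup.filter (fun p => decide (p ∈ s.available b))
        have := hnd.length_le_card
        simpa using this
      refine OracleAlg.Achieves.mono (Q := fun a => f o + 2 * f s ≤ 3 * f a + 4 * ε * (j + 1 : ℕ))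
        (OracleAlg.achieves_queryAll (N := j * (n * k)) (rule.nodup.filter _) ?_)
        (by rw [add_mul]; omega) (fun _ h => h)
      intro w hw _
      have hmem := rule.tie_mem s (argmaxSet (s.available b) w) (argmaxSet_nonempty hav w)
      set p := rule.tie s (argmaxSet (s.available b) w) (argmaxSet_nonempty hav w)
      obtain ⟨hpav, hpmax⟩ := mem_argmaxSet.1 hmem
      have hacc : ∀ q ∈ s.available b, |w q - f (s.assign q.1 q.2)| ≤ ε := fun q hq =>
        hw q (List.mem_filter.2 ⟨rule.complete q, by simpa using hq⟩)
      obtain ⟨o', hext', hfeas', hloss⟩ := KAssign.exists_exchange hf hm hext ho hε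
        -- The slack `2 * ε` comes from comparing two answers, each off by at most `ε`.
        (e := p.1) (i := p.2) hpav (by
          intro d i hdi
          have h1 := abs_le.1 (hacc _ hdi)
          have h2 := abs_le.1 (hacc _ hpav)
          have h3 := hpmax _ hdi
          unfold KAssign.marginal
          simp only at h1
          linarith [h1.1, h2.2])
      refine (ih (s.assign p.1 p.2) o' hext' hfeas' ?_).mono le_rfl ?_
      · rw [KAssign.sum_card_part_assign s p.2 (KAssign.mem_available.1 hpav).1]
        omega
      · intro a ha
        unfold KAssign.marginal at hloss
        push_cast
        linarith
    · have := hext.eq_of_available_eq_empty ho hav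
      subst this
      refine .ret ?_
      have : 0 ≤ 4 * ε * ((j + 1 : ℕ) : ℝ) := by positivity
      linarith

theorem greedyIS_achieves {n k : ℕ} (rule : GreedyRule n k) (b : Fin k → ℕ)
    {f : KAssign n k → ℝ} (hf : KAssign.IsKSubmodular f) (hm : KAssign.IsMonotone f)
    {ε : ℝ} (hε : 0 ≤ ε) {o : KAssign n k} (ho : KAssign.Feasible b o) :
    OracleAlg.Achieves f ε
      (fun a => f o + 2 * f KAssign.empty ≤ 3 * f a + 4 * ε * (∑ i, b i : ℕ))
      ((∑ i, b i) * (n * k)) (greedyIS rule b) :=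
  greedyLoop_achieves rule b hf hm hε _ _ _ (fun e he => absurd rfl he) ho (by omega)

/-! ### Explore-then-commit -/

/-- The mean of the rewards in the `q`-th block of `m` rounds. -/
noncomputable def blockMean (m : ℕ) (r : ℕ → ℝ) (q : ℕ) : ℝ :=
  (∑ i ∈ Finset.range m, r (q * m + i)) / m

theorem drop_map_range (r : ℕ → ℝ) (m t : ℕ) :
    ((List.range (m + t)).map r).drop m = (List.range t).map (fun i => r (m + i)) := by
  rw [List.range_add, List.map_append, List.drop_left' (by simp), List.map_map]
  rfl

theorem take_map_range_sum (r : ℕ → ℝ) (m t : ℕ) :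
    (((List.range (m + t)).map r).take m).sum = ∑ i ∈ Finset.range m, r i := by
  rw [List.range_add, List.map_append, List.take_left' (by simp)]
  rfl

theorem exploreThenCommit_query_of_lt {A : Type} {m t : ℕ} (h : t < m) (a : A)
    (cont : ℝ → OracleAlg A) (r : ℕ → ℝ) :
    exploreThenCommit m (.query a cont) ((List.range t).map r) = a := by
  simp [exploreThenCommit, h]

/-- A complete block answers one query, and the remaining history is a run of the continuation with
time shifted by `m`. Inductions on the algorithm peel off one block in this way. -/
theorem exploreThenCommit_query_add {A : Type} (m t : ℕ) (a : A)
    (cont : ℝ → OracleAlg A) (r : ℕ → ℝ) :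
    exploreThenCommit m (.query a cont) ((List.range (m + t)).map r) =
      exploreThenCommit m (cont (blockMean m r 0))
        ((List.range t).map (fun i => r (m + i))) := by
  rw [exploreThenCommit, if_neg (by simp), take_map_range_sum, drop_map_range]
  simp [blockMean]

theorem blockMean_shift (m : ℕ) (r : ℕ → ℝ) (q : ℕ) :
    blockMean m (fun i => r (m + i)) q = blockMean m r (q + 1) := by
  unfold blockMean
  congr 1
  refine Finset.sum_congr rfl fun i _ => ?_
  change r (m + (q * m + i)) = r ((q + 1) * m + i)
  congr 1
  ring

/-- The action does not change within a block. -/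
theorem exploreThenCommit_block {A : Type} {m : ℕ} (alg : OracleAlg A) (r : ℕ → ℝ) (q : ℕ)
    {i : ℕ} (hi : i < m) :
    exploreThenCommit m alg ((List.range (q * m + i)).map r) =
      exploreThenCommit m alg ((List.range (q * m)).map r) := by
  induction alg generalizing r q with
  | ret a => rfl
  | query a cont ih =>
    cases q with
    | zero =>
      rw [exploreThenCommit_query_of_lt (by omega), exploreThenCommit_query_of_lt (by omega)]
    | succ q =>
      rw [show (q + 1) * m + i = m + (q * m + i) by ring, show (q + 1) * m = m + q * m by ring,
        exploreThenCommit_query_add, exploreThenCommit_query_add, ih]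

/-- If the empirical means of the first `N` blocks are accurate, then the algorithm commits to an
action that satisfies `Q` after at most `N` blocks. -/
theorem exploreThenCommit_of_achieves {A : Type} {f : A → ℝ} {ε : ℝ} {Q : A → Prop}
    {N : ℕ} {alg : OracleAlg A} (h : OracleAlg.Achieves f ε Q N alg) {m : ℕ} (hm : 0 < N → 0 < m) (r : ℕ → ℝ)
    (hr : ∀ q < N, |blockMean m r q -
      f (exploreThenCommit m alg ((List.range (q * m)).map r))| ≤ ε)
    {t : ℕ} (ht : N * m ≤ t) :
    Q (exploreThenCommit m alg ((List.range t).map r)) := by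
  induction h generalizing r t with
  | ret h => exact h
  | @query N a cont _ ih =>
    have hm : 0 < m := hm N.succ_pos
    obtain ⟨t, rfl⟩ := Nat.exists_eq_add_of_le (show m ≤ t by nlinarith)
    rw [exploreThenCommit_query_add]
    refine ih _ ?_ (fun _ => hm) _ (fun q hq => ?_) (by nlinarith)
    · have := hr 0 (by omega)
      rwa [Nat.zero_mul, exploreThenCommit_query_of_lt hm] at this
    · have := hr (q + 1) (by omega)
      rwa [show (q + 1) * m = m + q * m by ring, exploreThenCommit_query_add,
        ← blockMean_shift] at this

theorem rewardHistory_eq_map {A : Type} (π : BanditPolicy A) (F : ℕ → A → ℝ) (t : ℕ) :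
    rewardHistory π F t = (List.range t).map (fun s => F s (playedAction π F s)) := by
  induction t with
  | zero => rfl
  | succ t ih => rw [rewardHistory, List.range_succ, List.map_append, ← ih]; rfl

theorem rewardHistory_congr {A : Type} (π : BanditPolicy A) {F G : ℕ → A → ℝ} {t : ℕ}
    (h : ∀ s < t, F s = G s) : rewardHistory π F t = rewardHistory π G t := by
  induction t with
  | zero => rfl
  | succ t ih =>
    rw [rewardHistory, rewardHistory, ih fun s hs => h s (by omega), h t (by omega)]

theorem playedAction_congr {A : Type} (π : BanditPolicy A) {F G : ℕ → A → ℝ} {t : ℕ}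
    (h : ∀ s < t, F s = G s) : playedAction π F t = playedAction π G t := by
  rw [playedAction, playedAction, rewardHistory_congr π h]

/-- The guarantee of explore-then-commit on the event that, in each of the first `N` blocks, the
mean reward of the action played in this block is accurate. -/
theorem playedAction_of_achieves {A : Type} {f : A → ℝ} {ε : ℝ} {Q : A → Prop}
    {N : ℕ} {alg : OracleAlg A} (h : OracleAlg.Achieves f ε Q N alg) {m : ℕ} (hm : 0 < N → 0 < m)
    (F : ℕ → A → ℝ)
    (hF : ∀ q < N, |blockMean m
        (fun s => F s (playedAction (exploreThenCommit m alg) F (q * m))) q -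
      f (playedAction (exploreThenCommit m alg) F (q * m))| ≤ ε)
    {t : ℕ} (ht : N * m ≤ t) :
    Q (playedAction (exploreThenCommit m alg) F t) := by
  rw [playedAction, rewardHistory_eq_map]
  refine exploreThenCommit_of_achieves h hm _ (fun q hq => ?_) ht
  rw [← rewardHistory_eq_map]
  refine le_trans (le_of_eq ?_) (hF q hq)
  congr 2
  unfold blockMean
  congr 1
  -- The actual rewards of a block are those of the action played in its first round.
  refine Finset.sum_congr rfl fun i hi => ?_
  refine congrArg (F (q * m + i)) ?_
  unfold playedAction
  rw [rewardHistory_eq_map, rewardHistory_eq_map]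
  exact exploreThenCommit_block alg _ q (Finset.mem_range.1 hi)

/-! ### Measurability of the played actions -/

section Measurability

variable {X : Type*} [MeasurableSpace X]

theorem measurable_argmaxSet {P : Type} [Finite P] (S : Finset P) {v : X → P → ℝ}
    (hv : ∀ p, Measurable fun x => v x p) (R : Finset P) :
    MeasurableSet {x | argmaxSet S (v x) = R} := by
  have : {x | argmaxSet S (v x) = R} =
      ⋂ p, {x | (p ∈ S ∧ ∀ q ∈ S, v x q ≤ v x p) ↔ p ∈ R} := by
    ext x
    simp [Finset.ext_iff, mem_argmaxSet]
  rw [this]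
  refine MeasurableSet.iInter fun p => ?_
  have h1 : MeasurableSet {x | p ∈ S ∧ ∀ q ∈ S, v x q ≤ v x p} := by
    have : {x | p ∈ S ∧ ∀ q ∈ S, v x q ≤ v x p} =
        {_x | p ∈ S} ∩ ⋂ q ∈ S, {x | v x q ≤ v x p} := by
      ext x; simp
    rw [this]
    exact (MeasurableSet.const _).inter
      (Finset.measurableSet_biInter _ fun q _ => measurableSet_le (hv q) (hv p))
  by_cases hp : p ∈ R
  · simpa only [hp, iff_true] using h1
  · simp only [hp, iff_false]
    exact h1.compl

/-- A history is a fixed list of measurable functions evaluated at `x`. Its length is thus constant,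
the branch of the policy does not depend on `x`, and no σ-algebra on `List ℝ` is needed. -/
theorem measurableSet_exploreThenCommit_queryAll {A P : Type} [DecidableEq P] (m : ℕ)
    (act : P → A) (a : A) {cont : (P → ℝ) → OracleAlg A}
    (hcont : ∀ (v : X → P → ℝ) (H : List (X → ℝ)), (∀ p, Measurable fun x => v x p) →
      (∀ g ∈ H, Measurable g) →
      MeasurableSet {x | exploreThenCommit m (cont (v x)) (H.map (· x)) = a})
    (ps : List P) (v : X → P → ℝ) (H : List (X → ℝ)) (hv : ∀ p, Measurable fun x => v x p)
    (hH : ∀ g ∈ H, Measurable g) :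
    MeasurableSet
      {x | exploreThenCommit m (OracleAlg.queryAll act ps (v x) cont) (H.map (· x)) = a} := by
  induction ps generalizing v H with
  | nil => exact hcont v H hv hH
  | cons p ps ih =>
    simp only [OracleAlg.queryAll, exploreThenCommit, List.length_map]
    split_ifs
    · exact MeasurableSet.const _
    · simp only [← List.map_take, ← List.map_drop]
      refine ih _ _ (fun q => ?_) (fun g hg => hH g (List.mem_of_mem_drop hg))
      by_cases hq : q = p
      · subst hq
        simp only [Function.update_self]
        refine Measurable.div_const ?_ _
        have : ∀ L : List (X → ℝ), (∀ g ∈ L, Measurable g) →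
            Measurable fun x => (L.map (· x)).sum := by
          intro L hL
          induction L with
          | nil => exact measurable_const
          | cons g L ihL =>
            simp only [List.map_cons, List.sum_cons]
            exact (hL g (by simp)).add (ihL fun g' hg' => hL g' (by simp [hg']))
        exact this _ fun g hg => hH g (List.mem_of_mem_take hg)
      · simpa [Function.update_of_ne hq] using hv q

theorem measurableSet_exploreThenCommit_greedyLoop {n k : ℕ} (rule : GreedyRule n k)
    (b : Fin k → ℕ) (m j : ℕ) (s a : KAssign n k) (H : List (X → ℝ))
    (hH : ∀ g ∈ H, Measurable g) :
    MeasurableSet {x | exploreThenCommit m (greedyLoop rule b j s) (H.map (· x)) = a} := by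
  induction j generalizing s H with
  | zero => exact MeasurableSet.const (s = a)
  | succ j ih =>
    rw [greedyLoop]
    split_ifs with hav
    · refine measurableSet_exploreThenCommit_queryAll m _ a (fun v H hv hH => ?_) _ _ H
        (fun _ => measurable_const) hH
      let R : X → Finset (Fin n × Fin k) := fun x => argmaxSet (s.available b) (v x)
      have hR : ∀ x, (R x).Nonempty := fun x => argmaxSet_nonempty hav (v x)
      -- The tie rule sees the answers only through the set of maximizers, which has finitely many
      -- possible values; splitting over them makes the chosen pair constant.
      have : {x | exploreThenCommit m (greedyLoop rule b j
            (s.assign (rule.tie s (R x) (hR x)).1 (rule.tie s (R x) (hR x)).2))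
            (H.map (· x)) = a} =
          ⋃ (S : Finset (Fin n × Fin k)) (hS : S.Nonempty), {x | R x = S} ∩
            {x | exploreThenCommit m (greedyLoop rule b j
              (s.assign (rule.tie s S hS).1 (rule.tie s S hS).2)) (H.map (· x)) = a} := by
        ext x
        simp only [Set.mem_iUnion, Set.mem_inter_iff, Set.mem_ofPred_eq]
        constructor
        · intro h
          exact ⟨R x, hR x, rfl, h⟩
        · rintro ⟨S, hS, rfl, h⟩
          exact h
      refine Eq.mpr (congrArg MeasurableSet this) ?_
      exact MeasurableSet.iUnion fun S => MeasurableSet.iUnion fun hS =>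
        (measurable_argmaxSet _ hv S).inter (ih _ H hH)
    · exact MeasurableSet.const (s = a)

/-- A policy whose decisions depend measurably on the rewards. -/
def BanditPolicy.IsMeasurable {A : Type} (π : BanditPolicy A) : Prop :=
  ∀ (H : List ((ℕ → A → ℝ) → ℝ)), (∀ g ∈ H, Measurable g) →
    ∀ a, MeasurableSet {G | π (H.map (· G)) = a}

theorem measurable_comp_of_finite {A : Type} [Finite A] {u : X → A → ℝ} {c : X → A}
    (hu : ∀ a, Measurable fun x => u x a) (hc : ∀ a, MeasurableSet {x | c x = a}) :
    Measurable fun x => u x (c x) := by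
  intro S hS
  have : (fun x => u x (c x)) ⁻¹' S = ⋃ a, {x | c x = a} ∩ (fun x => u x a) ⁻¹' S := by
    ext x; simp
  rw [this]
  exact MeasurableSet.iUnion fun a => (hc a).inter (hu a hS)

theorem BanditPolicy.IsMeasurable.playedAction {A : Type} [Finite A] {π : BanditPolicy A}
    (hπ : π.IsMeasurable) (t : ℕ) (a : A) :
    MeasurableSet {G : ℕ → A → ℝ | _root_.playedAction π G t = a} := by
  have : ∃ H : List ((ℕ → A → ℝ) → ℝ), (∀ g ∈ H, Measurable g) ∧
      ∀ G, rewardHistory π G t = H.map (· G) := by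
    induction t with
    | zero => exact ⟨[], by simp, fun G => rfl⟩
    | succ t ih =>
      obtain ⟨H, hH, hG⟩ := ih
      refine ⟨H ++ [fun G => G t (π (H.map (· G)))], ?_, fun G => ?_⟩
      · intro g hg
        rcases List.mem_append.1 hg with hg | hg
        · exact hH g hg
        · rw [List.mem_singleton.1 hg]
          exact measurable_comp_of_finite (u := fun G : ℕ → A → ℝ => G t)
            (fun a => by fun_prop) (hπ H hH)
      · simp [rewardHistory, hG]
  obtain ⟨H, hH, hG⟩ := this
  simp only [_root_.playedAction, hG]
  exact hπ H hH a

theorem isMeasurable_cetcGreedyIS {n k : ℕ} (rule : GreedyRule n k) (b : Fin k → ℕ) (T : ℕ) :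
    (cetcGreedyIS rule b T).IsMeasurable := fun H hH a =>
  measurableSet_exploreThenCommit_greedyLoop rule b _ _ _ a H hH

end Measurability

/-! ### Independence and concentration -/

namespace IsRewardProcess

variable {Ω : Type*} {A : Type} [MeasurableSpace Ω] {μ : Measure Ω}
  {F : ℕ → Ω → A → ℝ}

theorem measurable_apply (hF : IsRewardProcess μ F) (t : ℕ) (a : A) :
    Measurable fun ω => F t ω a := (measurable_pi_apply a).comp (hF.measurable t)

theorem identDistrib_apply (hF : IsRewardProcess μ F) (t : ℕ) (a : A) :
    IdentDistrib (fun ω => F t ω a) (fun ω => F 0 ω a) μ μ :=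
  (hF.identDistrib t).comp (measurable_pi_apply a)

theorem integral_apply (hF : IsRewardProcess μ F) (t : ℕ) (a : A) :
    ∫ ω, F t ω a ∂μ = expectedReward μ F a := (hF.identDistrib_apply t a).integral_eq

theorem measurable_process (hF : IsRewardProcess μ F) :
    Measurable fun ω => (fun t => F t ω) := measurable_pi_lambda _ hF.measurable

/-- The action of round `t` is independent of the rewards from round `t` on. -/
theorem indepFun_playedAction [Finite A] (hF : IsRewardProcess μ F) {π : BanditPolicy A}
    (hπ : π.IsMeasurable) (t : ℕ) {J : Finset ℕ} (hJ : ∀ s ∈ J, t ≤ s) :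
    @IndepFun _ _ _ _ ⊤ inferInstance (fun ω => playedAction π (fun s => F s ω) t)
      (fun ω (s : J) => F s ω) μ := by
  classical
  let : MeasurableSpace A := ⊤
  have hdisj : Disjoint (Finset.range t) J := by
    rw [Finset.disjoint_left]
    intro s hs hs'
    have := hJ s hs'
    have := Finset.mem_range.1 hs
    omega
  have hind := hF.indep.indepFun_finset (Finset.range t) J hdisj hF.measurable
  -- Padding by zero is harmless, since the action of round `t` ignores the rewards from round `t`
  -- on.
  let ext : (Finset.range t → A → ℝ) → ℕ → A → ℝ :=
    fun g s => if h : s ∈ Finset.range t then g ⟨s, h⟩ else 0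
  have hext : Measurable ext := by
    refine measurable_pi_lambda _ fun s => ?_
    by_cases h : s ∈ Finset.range t
    · simp only [ext, h, dif_pos]
      exact measurable_pi_apply _
    · simp only [ext, h, dif_neg, not_false_eq_true]
      exact measurable_const
  have hplay : Measurable fun G : ℕ → A → ℝ => playedAction π G t :=
    measurable_to_countable' fun a => hπ.playedAction t a
  have heq : (fun ω => playedAction π (fun s => F s ω) t) =
      (fun g => playedAction π (ext g) t) ∘ fun ω (s : Finset.range t) => F s ω := by
    funext ω
    refine playedAction_congr π fun s hs => ?_
    simp [ext, hs]
  rw [heq]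
  exact hind.comp (hplay.comp hext) measurable_id

theorem measurableSet_playedAction [Finite A] (hF : IsRewardProcess μ F) {π : BanditPolicy A}
    (hπ : π.IsMeasurable) (t : ℕ) (a : A) :
    MeasurableSet {ω | playedAction π (fun s => F s ω) t = a} :=
  hF.measurable_process (hπ.playedAction t a)

theorem measurable_reward [Finite A] (hF : IsRewardProcess μ F) {π : BanditPolicy A}
    (hπ : π.IsMeasurable) (t : ℕ) :
    Measurable fun ω => F t ω (playedAction π (fun s => F s ω) t) :=
  measurable_comp_of_finite (hF.measurable_apply t) (hF.measurableSet_playedAction hπ t)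

variable [IsProbabilityMeasure μ]

theorem integrable_apply (hF : IsRewardProcess μ F) (t : ℕ) (a : A) :
    Integrable (fun ω => F t ω a) μ :=
  Integrable.of_mem_Icc 0 1 (hF.measurable_apply t a).aemeasurable (hF.bounded t a)

theorem expectedReward_mem_Icc (hF : IsRewardProcess μ F) (a : A) :
    expectedReward μ F a ∈ Set.Icc (0 : ℝ) 1 := by
  constructor
  · exact integral_nonneg_of_ae ((hF.bounded 0 a).mono fun ω h => h.1)
  · have := integral_mono_ae (hF.integrable_apply 0 a) (integrable_const (1 : ℝ))
      ((hF.bounded 0 a).mono fun ω h => h.2)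
    simpa [expectedReward] using this

/-- Hoeffding's inequality for the empirical mean of a fixed action. -/
theorem measure_blockMean_le (hF : IsRewardProcess μ F) {m : ℕ} (hm : 0 < m) (q : ℕ) (a : A)
    {ε : ℝ} (hε : 0 ≤ ε) :
    μ.real {ω | ε < |blockMean m (fun s => F s ω a) q - expectedReward μ F a|} ≤
      2 * Real.exp (-2 * m * ε ^ 2) := by
  set Y : ℕ → Ω → ℝ := fun i ω => F (q * m + i) ω a - expectedReward μ F a
  -- Hoeffding's lemma: the variance proxy on `[0, 1]` is `((1 - 0) / 2) ^ 2 = 1 / 4`.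
  have hsub : ∀ i, HasSubgaussianMGF (Y i) (1 / 4) μ := by
    intro i
    have := hasSubgaussianMGF_of_mem_Icc (hF.measurable_apply (q * m + i) a).aemeasurable
      (hF.bounded (q * m + i) a)
    rw [hF.integral_apply] at this
    convert this using 1
    ext; norm_num
  have hindep : iIndepFun Y μ :=
    (hF.indep.precomp (g := fun i => q * m + i) (fun i j h => by simpa using h)).comp
      (fun _ u => u a - expectedReward μ F a)
      (fun _ => (measurable_pi_apply a).sub_const _)
  have hindep' : iIndepFun (fun i => -Y i) μ :=
    hindep.comp (fun _ x => -x) (fun _ => measurable_neg)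
  have hm' : (0 : ℝ) < m := by exact_mod_cast hm
  have h1 := HasSubgaussianMGF.measure_sum_range_ge_le_of_iIndepFun hindep (c := 1 / 4) (n := m)
    (fun i _ => hsub i) (ε := m * ε) (by positivity)
  have h2 := HasSubgaussianMGF.measure_sum_range_ge_le_of_iIndepFun hindep' (c := 1 / 4) (n := m)
    (fun i _ => (hsub i).neg) (ε := m * ε) (by positivity)
  have hexp : -(m * ε) ^ 2 / (2 * m * ((1 / 4 : NNReal) : ℝ)) = -2 * m * ε ^ 2 := by
    push_cast
    field_simp
    ring
  rw [hexp] at h1 h2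
  calc _ ≤ μ.real ({ω | m * ε ≤ ∑ i ∈ Finset.range m, Y i ω} ∪
        {ω | m * ε ≤ ∑ i ∈ Finset.range m, (-Y i) ω}) := by
        refine measureReal_mono fun ω hω => ?_
        have hY : blockMean m (fun s => F s ω a) q - expectedReward μ F a =
            (∑ i ∈ Finset.range m, Y i ω) / m := by
          simp only [blockMean, Y, Finset.sum_sub_distrib, Finset.sum_const, Finset.card_range,
            nsmul_eq_mul]
          field_simp
        simp only [Set.mem_ofPred_eq, hY] at hω
        simp only [Set.mem_union, Set.mem_ofPred_eq, Pi.neg_apply, Finset.sum_neg_distrib]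
        rcases lt_abs.1 hω with h | h
        · left
          rw [lt_div_iff₀ hm'] at h
          linarith
        · right
          rw [← neg_div, lt_div_iff₀ hm'] at h
          linarith
    _ ≤ _ := (measureReal_union_le _ _).trans (by linarith)

variable [Finite A]

theorem integrable_reward (hF : IsRewardProcess μ F) {π : BanditPolicy A}
    (hπ : π.IsMeasurable) (t : ℕ) :
    Integrable (fun ω => F t ω (playedAction π (fun s => F s ω) t)) μ := by
  refine Integrable.of_mem_Icc 0 1 (hF.measurable_reward hπ t).aemeasurable ?_
  filter_upwards [ae_all_iff.2 fun a => hF.bounded t a] with ω hω using hω _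

theorem integrable_expectedReward (hF : IsRewardProcess μ F) {π : BanditPolicy A}
    (hπ : π.IsMeasurable) (t : ℕ) :
    Integrable (fun ω => expectedReward μ F (playedAction π (fun s => F s ω) t)) μ :=
  Integrable.of_mem_Icc 0 1 (measurable_comp_of_finite (u := fun _ => expectedReward μ F)
    (fun _ => measurable_const) (hF.measurableSet_playedAction hπ t)).aemeasurable
    (ae_of_all _ fun _ => hF.expectedReward_mem_Icc _)

/-- Split over the finitely many values of the action: the event that `a` is played in round `t` is
independent of the reward `F t ω a`. -/
theorem integral_reward (hF : IsRewardProcess μ F) {π : BanditPolicy A}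
    (hπ : π.IsMeasurable) (t : ℕ) :
    ∫ ω, F t ω (playedAction π (fun s => F s ω) t) ∂μ =
      ∫ ω, expectedReward μ F (playedAction π (fun s => F s ω) t) ∂μ := by
  classical
  have := Fintype.ofFinite A
  set c : Ω → A := fun ω => playedAction π (fun s => F s ω) t
  have hc : ∀ a, MeasurableSet {ω | c ω = a} := hF.measurableSet_playedAction hπ t
  have hsplit : ∀ u : Ω → A → ℝ, (fun ω => u ω (c ω)) =
      fun ω => ∑ a, {ω | c ω = a}.indicator 1 ω * u ω a := by
    intro u
    funext ω
    simp [Set.indicator_apply]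
  have hbd : ∀ a ω, ‖{ω | c ω = a}.indicator (1 : Ω → ℝ) ω‖ ≤ 1 := by
    intro a ω
    rw [Set.indicator_apply]
    split_ifs <;> simp
  rw [hsplit, hsplit fun _ => expectedReward μ F,
    integral_finsetSum, integral_finsetSum]
  · refine Finset.sum_congr rfl fun a _ => ?_
    have hind : IndepFun ({ω | c ω = a}.indicator (1 : Ω → ℝ)) (fun ω => F t ω a) μ := by
      have h := hF.indepFun_playedAction hπ t (J := {t}) (by simp)
      have := h.comp (φ := ({a} : Set A).indicator (1 : A → ℝ))
        (ψ := fun g => g ⟨t, Finset.mem_singleton_self t⟩ a)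
        (@measurable_from_top A ℝ _ _) (by fun_prop)
      exact this
    rw [hind.integral_fun_mul_eq_mul_integral, hF.integral_apply, integral_mul_const]
    · exact (measurable_const.indicator (hc a)).aestronglyMeasurable
    · exact (hF.measurable_apply t a).aestronglyMeasurable
  · intro a _
    exact (integrable_const _).bdd_mul (c := 1)
      (measurable_const.indicator (hc a)).aestronglyMeasurable (ae_of_all _ (hbd a))
  · intro a _
    exact (hF.integrable_apply t a).bdd_mul (c := 1)
      (measurable_const.indicator (hc a)).aestronglyMeasurable (ae_of_all _ (hbd a))

/-- The empirical mean of the action that is played at the beginning of the `q`-th block. -/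
theorem measure_blockMean_playedAction_le (hF : IsRewardProcess μ F) {π : BanditPolicy A}
    (hπ : π.IsMeasurable) {m : ℕ} (hm : 0 < m) (q : ℕ) {ε : ℝ} (hε : 0 ≤ ε) :
    μ.real {ω | ε < |blockMean m
        (fun s => F s ω (playedAction π (fun s => F s ω) (q * m))) q -
        expectedReward μ F (playedAction π (fun s => F s ω) (q * m))|} ≤
      2 * Real.exp (-2 * m * ε ^ 2) := by
  classical
  have := Fintype.ofFinite A
  set c : Ω → A := fun ω => playedAction π (fun s => F s ω) (q * m)
  let D : A → Set Ω := fun a =>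
    {ω | ε < |blockMean m (fun s => F s ω a) q - expectedReward μ F a|}
  have hsub : {ω | ε < |blockMean m (fun s => F s ω (c ω)) q - expectedReward μ F (c ω)|} ⊆
      ⋃ a ∈ (Finset.univ : Finset A), {ω | c ω = a} ∩ D a := by
    intro ω hω
    simp only [Set.mem_iUnion]
    exact ⟨c ω, Finset.mem_univ _, rfl, hω⟩
  -- Independence of the action from its block makes the failure probability an average over `a` of
  -- fixed-action probabilities, so no factor for the number of actions arises.
  have hprod : ∀ a, μ.real ({ω | c ω = a} ∩ D a) = μ.real {ω | c ω = a} * μ.real (D a) := by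
    intro a
    let J : Finset ℕ := (Finset.range m).image (q * m + ·)
    let E : Set (J → A → ℝ) := {g | ε < |(∑ i : Fin m,
      g ⟨q * m + i, Finset.mem_image_of_mem _ (Finset.mem_range.2 i.2)⟩ a) / m -
      expectedReward μ F a|}
    have hE : MeasurableSet E := measurableSet_lt measurable_const (by fun_prop)
    have hD : D a = {ω | (fun s : J => F s ω) ∈ E} := by
      ext ω
      simp only [D, E, blockMean, Set.mem_ofPred_eq, Finset.sum_range]
    rw [hD, measureReal_def, measureReal_def, measureReal_def, ← ENNReal.toReal_mul]
    congr 1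
    refine (hF.indepFun_playedAction hπ (q * m) (J := J) fun s hs => ?_).measure_inter_preimage_eq_mul
      {a} E (by trivial) hE
    obtain ⟨i, -, rfl⟩ := Finset.mem_image.1 hs
    omega
  have hone : ∑ a, μ.real {ω | c ω = a} = 1 := by
    rw [← measureReal_biUnion_finset]
    · have : (⋃ a ∈ (Finset.univ : Finset A), {ω | c ω = a}) = Set.univ := by ext; simp
      rw [this]; simp
    · intro a _ a' _ h
      exact Set.disjoint_left.2 fun ω h1 h2 => h (h1.symm.trans h2)
    · exact fun a _ => hF.measurableSet_playedAction hπ _ a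
  calc _ ≤ μ.real (⋃ a ∈ (Finset.univ : Finset A), {ω | c ω = a} ∩ D a) := measureReal_mono hsub (measure_ne_top _ _)
    _ ≤ ∑ a, μ.real ({ω | c ω = a} ∩ D a) := measureReal_biUnion_finset_le _ _
    _ ≤ ∑ a, μ.real {ω | c ω = a} * (2 * Real.exp (-2 * m * ε ^ 2)) := by
        refine Finset.sum_le_sum fun a _ => ?_
        rw [hprod]
        exact mul_le_mul_of_nonneg_left (hF.measure_blockMean_le hm q a hε) measureReal_nonneg
    _ = _ := by rw [← Finset.sum_mul, hone, one_mul]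

end IsRewardProcess

/-! ### The regret of explore-then-commit -/

namespace IsRewardProcess

variable {Ω : Type*} {A : Type} [MeasurableSpace Ω] {μ : Measure Ω} [IsProbabilityMeasure μ]
  {F : ℕ → Ω → A → ℝ} [Finite A]

theorem integrable_cumulativeReward (hF : IsRewardProcess μ F) {π : BanditPolicy A}
    (hπ : π.IsMeasurable) (T : ℕ) :
    Integrable (fun ω => cumulativeReward π (fun t => F t ω) T) μ :=
  integrable_finsetSum _ fun t _ => hF.integrable_reward hπ t

/-- After the exploration phase, the expected reward is at least `v` up to the probability that
some empirical mean was inaccurate. -/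
theorem sub_le_integral_committed (hF : IsRewardProcess μ F) {alg : OracleAlg A} {m N : ℕ}
    (hm : 0 < N → 0 < m) (hπ : (exploreThenCommit m alg).IsMeasurable) {ε v : ℝ} (hε : 0 ≤ ε)
    (hv : v ≤ 1)
    (halg : OracleAlg.Achieves (expectedReward μ F) ε (fun a => v ≤ expectedReward μ F a) N alg)
    {t : ℕ} (ht : N * m ≤ t) :
    v - N * (2 * Real.exp (-2 * m * ε ^ 2)) ≤
      ∫ ω, expectedReward μ F (playedAction (exploreThenCommit m alg) (fun s => F s ω) t) ∂μ := by
  set π := exploreThenCommit m alg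
  set f := expectedReward μ F
  let D : ℕ → Set Ω := fun q => {ω | ε < |blockMean m
        (fun s => F s ω (playedAction π (fun s => F s ω) (q * m))) q -
        f (playedAction π (fun s => F s ω) (q * m))|}
  let D' : Set Ω := ⋃ q ∈ Finset.range N, D q
  have hD : ∀ q, MeasurableSet (D q) := by
    intro q
    have h := measurable_comp_of_finite
      (u := fun ω a => |blockMean m (fun s => F s ω a) q - f a|)
      (c := fun ω => playedAction π (fun s => F s ω) (q * m))
      (fun a => by
        have := hF.measurable_apply
        unfold blockMean
        fun_prop)
      (hF.measurableSet_playedAction hπ (q * m))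
    exact measurableSet_lt measurable_const h
  have hD' : MeasurableSet D' := Finset.measurableSet_biUnion _ fun q _ => hD q
  have hprob : μ.real D' ≤ N * (2 * Real.exp (-2 * m * ε ^ 2)) := by
    calc μ.real D' ≤ ∑ q ∈ Finset.range N, μ.real (D q) := measureReal_biUnion_finset_le _ _
      _ ≤ ∑ _q ∈ Finset.range N, 2 * Real.exp (-2 * m * ε ^ 2) :=
          Finset.sum_le_sum fun q hq => hF.measure_blockMean_playedAction_le hπ
            (hm (Nat.zero_lt_of_lt (Finset.mem_range.1 hq))) q hε
      _ = _ := by simp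
  -- On the bad event the bound reduces to `v - 1 ≤ 0`; elsewhere the offline guarantee applies.
  have hpt : ∀ ω, v - D'.indicator 1 ω ≤ f (playedAction π (fun s => F s ω) t) := by
    intro ω
    by_cases hω : ω ∈ D'
    · rw [Set.indicator_of_mem hω]
      have := (hF.expectedReward_mem_Icc (playedAction π (fun s => F s ω) t)).1
      simp only [Pi.one_apply]
      linarith
    · rw [Set.indicator_of_notMem hω, sub_zero]
      refine playedAction_of_achieves halg hm _ (fun q hq => ?_) ht
      by_contra hcon
      exact hω (Set.mem_biUnion (Finset.mem_coe.2 (Finset.mem_range.2 hq)) (not_le.1 hcon))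
  have hint : Integrable (D'.indicator (1 : Ω → ℝ)) μ := (integrable_const (1 : ℝ)).indicator hD'
  have hle := integral_mono ((integrable_const v).sub hint)
    (hF.integrable_expectedReward hπ t) hpt
  simp only [Pi.sub_apply] at hle
  rw [integral_sub (integrable_const v) hint, integral_indicator_one hD'] at hle
  simp only [integral_const, probReal_univ, smul_eq_mul, one_mul] at hle
  linarith

/-- An exploration round loses at most `v ≤ 1`, a later round at most the failure probability bound
`β`. No relation between `T` and `N * m` is needed. -/
theorem sub_integral_cumulativeReward_le (hF : IsRewardProcess μ F) {alg : OracleAlg A}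
    {m N : ℕ} (hm : 0 < N → 0 < m) (hπ : (exploreThenCommit m alg).IsMeasurable) {ε v : ℝ}
    (hε : 0 ≤ ε) (hv : v ≤ 1)
    (halg : OracleAlg.Achieves (expectedReward μ F) ε (fun a => v ≤ expectedReward μ F a) N alg)
    (T : ℕ) :
    T * v - ∫ ω, cumulativeReward (exploreThenCommit m alg) (fun t => F t ω) T ∂μ ≤
      N * m + T * (N * (2 * Real.exp (-2 * m * ε ^ 2))) := by
  set β : ℝ := N * (2 * Real.exp (-2 * m * ε ^ 2))
  have hβ : 0 ≤ β := by positivity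
  have hterm : ∀ t, v - β - (if t < N * m then 1 else 0) ≤
      ∫ ω, F t ω (playedAction (exploreThenCommit m alg) (fun s => F s ω) t) ∂μ := by
    intro t
    rw [hF.integral_reward hπ]
    split_ifs with ht
    · have : 0 ≤ ∫ ω, expectedReward μ F
          (playedAction (exploreThenCommit m alg) (fun s => F s ω) t) ∂μ :=
        integral_nonneg fun ω => (hF.expectedReward_mem_Icc _).1
      linarith
    · rw [sub_zero]
      exact hF.sub_le_integral_committed hm hπ hε hv halg (not_lt.1 ht)
  have hcard : ∑ t ∈ Finset.range T, (if t < N * m then (1 : ℝ) else 0) ≤ N * m := by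
    rw [Finset.sum_boole]
    have : ((Finset.range T).filter (· < N * m)).card ≤ N * m := by
      refine (Finset.card_le_card (t := Finset.range (N * m)) fun t ht => ?_).trans
        (Finset.card_range _).le
      exact Finset.mem_range.2 (Finset.mem_filter.1 ht).2
    exact_mod_cast this
  have hsum := Finset.sum_le_sum fun t (_ : t ∈ Finset.range T) => hterm t
  simp only [cumulativeReward]
  rw [integral_finsetSum _ fun t _ => hF.integrable_reward hπ t]
  rw [Finset.sum_sub_distrib, Finset.sum_const, Finset.card_range, nsmul_eq_mul] at hsum
  linarith

end IsRewardProcess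

theorem expectedRegret_cetcGreedyIS_le {n k : ℕ} {rule : GreedyRule n k} {b : Fin k → ℕ} {T : ℕ}
    {Ω : Type*} [MeasurableSpace Ω] {μ : Measure Ω} [IsProbabilityMeasure μ]
    {F : ℕ → Ω → KAssign n k → ℝ} {opt : KAssign n k} (hF : IsRewardProcess μ F)
    (hsub : KAssign.IsKSubmodular (expectedReward μ F))
    (hmon : KAssign.IsMonotone (expectedReward μ F)) (hopt : KAssign.Feasible b opt)
    {B N m : ℕ} (hB : B = ∑ i, b i) (hN : N = n * k * B)
    (hmdef : m = cetcReps (4 / 3 * ((B : ℝ) + 1)) ((n : ℝ) * k * B) T)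
    (hm : 0 < N → 0 < m) {ε : ℝ} (hε : 0 ≤ ε) :
    expectedRegret μ F (1 / 3) (cetcGreedyIS rule b T) T opt ≤
      N * m + T * (N * (2 * Real.exp (-2 * m * ε ^ 2))) + 4 / 3 * (T * ε * B) := by
  have hπ := isMeasurable_cetcGreedyIS rule b T
  have hpol : cetcGreedyIS rule b T = exploreThenCommit m (greedyIS rule b) := by
    rw [cetcGreedyIS, cetc, hmdef, hB]
  rw [hpol] at hπ ⊢
  have hf := hF.expectedReward_mem_Icc
  have halg := greedyIS_achieves rule b hsub hmon hε hopt
  have halg' : OracleAlg.Achieves (expectedReward μ F) ε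
      (fun a => 1 / 3 * expectedReward μ F opt - 4 / 3 * (ε * B) ≤ expectedReward μ F a) N
      (greedyIS rule b) := by
    refine halg.mono (by rw [hN, hB, mul_comm]) fun a ha => ?_
    have := (hf KAssign.empty).1
    rw [← hB] at ha
    linarith
  have hv : 1 / 3 * expectedReward μ F opt - 4 / 3 * (ε * B) ≤ 1 := by
    have := (hf opt).2
    have : 0 ≤ ε * B := by positivity
    linarith
  have := hF.sub_integral_cumulativeReward_le hm hπ hε hv halg' T
  unfold expectedRegret
  linarith

/-! ### Choice of the parameters -/

/-- The bound in terms of the cube roots `κ`, `β`, `τ`, `l`, `d` of `n k`, `B`, `T`, `log T`, `δ`. -/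
theorem explore_commit_tradeoff {κ β τ l d m : ℝ} (hκ : 1 ≤ κ) (hκτ : κ ≤ τ) (hβ : 1 ≤ β)
    (hl : 1 / 2 ≤ l) (hβd : β ≤ d) (hdβ : d ≤ 2 * β)
    (hm1 : d ^ 2 * τ ^ 2 * l / (2 * (κ * β) ^ 2) ≤ m)
    (hm2 : m ≤ d ^ 2 * τ ^ 2 * l / (2 * (κ * β) ^ 2) + 1) :
    l ^ 3 ≤ 2 * m * (2 * κ * l / τ) ^ 2 ∧
      κ ^ 3 * β ^ 3 * m + 2 * (κ ^ 3 * β ^ 3) + 4 / 3 * (τ ^ 3 * (2 * κ * l / τ) * β ^ 3) ≤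
        12 * (κ * β ^ 3 * τ ^ 2 * l) := by
  have hτ : 0 < τ := by linarith
  constructor
  -- Here `2 * κ * l / τ` is the accuracy `ε`; the claim `log T ≤ 2 * m * ε ^ 2` makes the Hoeffding
  -- exponential at most `1 / T`.
  · have h1 : d ^ 2 * τ ^ 2 * l / (2 * (κ * β) ^ 2) * (2 * κ * l / τ) ^ 2 =
        2 * (d / β) ^ 2 * l ^ 3 := by
      field_simp
    have h2 : d ^ 2 * τ ^ 2 * l / (2 * (κ * β) ^ 2) * (2 * κ * l / τ) ^ 2 ≤
        m * (2 * κ * l / τ) ^ 2 := mul_le_mul_of_nonneg_right hm1 (sq_nonneg _)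
    have h3 : 1 ≤ (d / β) ^ 2 := one_le_pow₀ ((one_le_div (by linarith)).2 hβd)
    have h4 : l ^ 3 ≤ (d / β) ^ 2 * l ^ 3 := le_mul_of_one_le_left (by positivity) h3
    have h5 : 0 < l ^ 3 := by positivity
    linarith
  · set G := κ * β ^ 3 * τ ^ 2 * l with hG
    have h1 : κ ^ 3 * β ^ 3 * (d ^ 2 * τ ^ 2 * l / (2 * (κ * β) ^ 2)) ≤ 2 * G := by
      have : κ ^ 3 * β ^ 3 * (d ^ 2 * τ ^ 2 * l / (2 * (κ * β) ^ 2)) =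
          κ * β * τ ^ 2 * l / 2 * d ^ 2 := by
        field_simp
      rw [this]
      have hd : d ^ 2 ≤ (2 * β) ^ 2 := pow_le_pow_left₀ (by linarith) hdβ 2
      calc _ ≤ κ * β * τ ^ 2 * l / 2 * (2 * β) ^ 2 :=
            mul_le_mul_of_nonneg_left hd (by positivity)
        _ = 2 * G := by rw [hG]; ring
    have h2 : κ ^ 3 * β ^ 3 ≤ 2 * G := by
      have hk : κ ^ 2 ≤ τ ^ 2 := pow_le_pow_left₀ (by linarith) hκτ 2
      calc κ ^ 3 * β ^ 3 = κ * β ^ 3 * κ ^ 2 := by ring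
        _ ≤ κ * β ^ 3 * τ ^ 2 := mul_le_mul_of_nonneg_left hk (by positivity)
        _ ≤ κ * β ^ 3 * τ ^ 2 * (2 * l) :=
            le_mul_of_one_le_right (by positivity) (by linarith)
        _ = 2 * G := by rw [hG]; ring
    have h3 : τ ^ 3 * (2 * κ * l / τ) * β ^ 3 = 2 * G := by
      rw [hG]
      field_simp
    have h4 := mul_le_mul_of_nonneg_left hm2 (show 0 ≤ κ ^ 3 * β ^ 3 by positivity)
    have h5 : 0 ≤ G := by positivity
    -- The constant: `2` for exploration, `2` for rounding `m` up, `4` for failures and `8/3` for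
    -- inaccuracy add up to less than `12`.
    linarith

theorem rpow_third_pow_three {x : ℝ} (hx : 0 ≤ x) : (x ^ (1 / 3 : ℝ)) ^ 3 = x := by
  rw [← Real.rpow_natCast, ← Real.rpow_mul hx]
  norm_num

theorem rpow_two_thirds {x : ℝ} (hx : 0 ≤ x) : x ^ (2 / 3 : ℝ) = (x ^ (1 / 3 : ℝ)) ^ 2 := by
  rw [← Real.rpow_natCast, ← Real.rpow_mul hx]
  norm_num

/-- For `B ≥ 1` the second entry of the maximum is at least `3 * √2 / 4 > 1`. This excludes `T = 1`,
where the logarithm in the regret bound vanishes. -/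
theorem one_lt_horizon {K B T : ℝ} (hK : 1 ≤ K) (hB : 1 ≤ B)
    (hT : K * max 1 (3 * √2 * B / (2 * (B + 1))) ≤ T) : 1 < T := by
  have h2 : (4 : ℝ) / 3 < √2 := Real.lt_sqrt_of_sq_lt (by norm_num)
  have h : 1 < 3 * √2 * B / (2 * (B + 1)) := by
    rw [lt_div_iff₀ (by linarith)]
    nlinarith
  have h' := h.trans_le (le_max_right 1 _)
  calc 1 < max 1 (3 * √2 * B / (2 * (B + 1))) := h'
    _ ≤ K * max 1 (3 * √2 * B / (2 * (B + 1))) := le_mul_of_one_le_left (by linarith) hK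
    _ ≤ T := hT

/-- A suitable accuracy `ε` for the number of repetitions in C-ETC. -/
theorem exists_accuracy {n k B T m : ℕ} (hn : 0 < n) (hk : 0 < k) (hB : 0 < B) (hT : 1 < T)
    (hnk : n * k ≤ T) (hm : m = cetcReps (4 / 3 * ((B : ℝ) + 1)) ((n : ℝ) * k * B) T) :
    0 < m ∧ ∃ ε : ℝ, 0 ≤ ε ∧
      ((n * k * B : ℕ) : ℝ) * m + T * ((n * k * B : ℕ) * (2 * Real.exp (-2 * m * ε ^ 2))) +
        4 / 3 * (T * ε * B) ≤
      12 * (n : ℝ) ^ (1 / 3 : ℝ) * (k : ℝ) ^ (1 / 3 : ℝ) * B * (T : ℝ) ^ (2 / 3 : ℝ) *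
        Real.log T ^ (1 / 3 : ℝ) := by
  have hn' : (1 : ℝ) ≤ n := by exact_mod_cast hn
  have hk' : (1 : ℝ) ≤ k := by exact_mod_cast hk
  have hB' : (1 : ℝ) ≤ B := by exact_mod_cast hB
  have hT' : (2 : ℝ) ≤ T := by exact_mod_cast hT
  have hK' : (1 : ℝ) ≤ n * k := one_le_mul_of_one_le_of_one_le hn' hk'
  have hKT : (n : ℝ) * k ≤ T := by exact_mod_cast hnk
  have hL : (1 / 2 : ℝ) ^ 3 ≤ Real.log T := by
    have := Real.log_two_gt_d9
    have h2 := Real.log_le_log (by norm_num) hT'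
    norm_num
    linarith
  have hL0 : 0 < Real.log T := lt_of_lt_of_le (by norm_num) hL
  have hT0 : (0 : ℝ) < T := by linarith
  set κ : ℝ := ((n : ℝ) * k) ^ (1 / 3 : ℝ)
  set β : ℝ := (B : ℝ) ^ (1 / 3 : ℝ)
  set τ : ℝ := (T : ℝ) ^ (1 / 3 : ℝ)
  set l : ℝ := Real.log T ^ (1 / 3 : ℝ)
  set d : ℝ := (4 / 3 * ((B : ℝ) + 1)) ^ (1 / 3 : ℝ)
  have hκ3 : κ ^ 3 = n * k := rpow_third_pow_three (by linarith)
  have hβ3 : β ^ 3 = B := rpow_third_pow_three (by linarith)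
  have hτ3 : τ ^ 3 = T := rpow_third_pow_three (by linarith)
  have hl3 : l ^ 3 = Real.log T := rpow_third_pow_three hL0.le
  have hd3 : d ^ 3 = 4 / 3 * ((B : ℝ) + 1) := rpow_third_pow_three (by linarith)
  have hβ0 : 0 ≤ β := by positivity
  have hd0 : 0 ≤ d := by positivity
  have hl0 : 0 ≤ l := by positivity
  have hκ1 : 1 ≤ κ := Real.one_le_rpow hK' (by norm_num)
  have hβ1 : 1 ≤ β := Real.one_le_rpow hB' (by norm_num)
  have hκτ : κ ≤ τ := Real.rpow_le_rpow (by linarith) hKT (by norm_num)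
  have hl1 : 1 / 2 ≤ l := le_of_pow_le_pow_left₀ three_ne_zero hl0 (hl3 ▸ hL)
  have hβd : β ≤ d := le_of_pow_le_pow_left₀ three_ne_zero hd0 (by rw [hβ3, hd3]; linarith)
  have hdβ : d ≤ 2 * β := le_of_pow_le_pow_left₀ three_ne_zero (by linarith)
    (by rw [mul_pow, hβ3, hd3]; linarith)
  have hx : (4 / 3 * ((B : ℝ) + 1)) ^ (2 / 3 : ℝ) * (T : ℝ) ^ (2 / 3 : ℝ) *
      Real.log T ^ (1 / 3 : ℝ) / (2 * ((n : ℝ) * k * B) ^ (2 / 3 : ℝ)) =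
      d ^ 2 * τ ^ 2 * l / (2 * (κ * β) ^ 2) := by
    rw [rpow_two_thirds (by positivity), rpow_two_thirds (by positivity),
      rpow_two_thirds (by positivity), Real.mul_rpow (x := (n : ℝ) * k) (by positivity) (by positivity)]
  have hxpos : 0 < d ^ 2 * τ ^ 2 * l / (2 * (κ * β) ^ 2) := by
    have : 0 < τ := by linarith
    have : 0 < d := by linarith
    positivity
  rw [cetcReps, hx] at hm
  have hm1 : d ^ 2 * τ ^ 2 * l / (2 * (κ * β) ^ 2) ≤ m := hm ▸ Nat.le_ceil _
  have hm2 : m ≤ d ^ 2 * τ ^ 2 * l / (2 * (κ * β) ^ 2) + 1 :=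
    hm ▸ (Nat.ceil_lt_add_one hxpos.le).le
  obtain ⟨hexp, hsum⟩ := explore_commit_tradeoff hκ1 hκτ hβ1 hl1 hβd hdβ hm1 hm2
  refine ⟨hm ▸ Nat.ceil_pos.2 hxpos, 2 * κ * l / τ, by positivity, ?_⟩
  have hexp' : Real.exp (-2 * m * (2 * κ * l / τ) ^ 2) ≤ (T : ℝ)⁻¹ := by
    rw [← Real.exp_log (inv_pos.2 hT0), Real.log_inv, Real.exp_le_exp]
    linarith
  have hTN : (T : ℝ) * ((n * k * B : ℕ) * (2 * Real.exp (-2 * m * (2 * κ * l / τ) ^ 2))) ≤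
      2 * (κ ^ 3 * β ^ 3) := by
    calc _ ≤ (T : ℝ) * ((n * k * B : ℕ) * (2 * (T : ℝ)⁻¹)) := by gcongr
      _ = 2 * (κ ^ 3 * β ^ 3) := by
        rw [hκ3, hβ3]
        push_cast
        field_simp
  have hN : ((n * k * B : ℕ) : ℝ) = κ ^ 3 * β ^ 3 := by
    rw [hκ3, hβ3]
    push_cast
    ring
  rw [rpow_two_thirds hT0.le, mul_assoc (12 : ℝ), ← Real.mul_rpow (by linarith) (by linarith)]
  calc _ ≤ κ ^ 3 * β ^ 3 * m + 2 * (κ ^ 3 * β ^ 3) +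
        4 / 3 * (τ ^ 3 * (2 * κ * l / τ) * β ^ 3) := by
        rw [hN] at hTN ⊢
        rw [hβ3] at hTN ⊢
        rw [hτ3]
        linarith
    _ ≤ _ := hsum
    _ = _ := by rw [hβ3]; ring

theorem mainTheorem3 :
    ∃ C : ℝ, 0 < C ∧
      ∀ (n k : ℕ) (b : Fin k → ℕ) (T : ℕ) (rule : GreedyRule n k)
        (Ω : Type*) [MeasurableSpace Ω] (μ : Measure Ω) [IsProbabilityMeasure μ]
        (F : ℕ → Ω → KAssign n k → ℝ) (opt : KAssign n k),
        IsRewardProcess μ F →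
        KAssign.IsKSubmodular (expectedReward μ F) →
        KAssign.IsMonotone (expectedReward μ F) →
        KAssign.Feasible b opt →
        (∀ x, KAssign.Feasible b x → expectedReward μ F x ≤ expectedReward μ F opt) →
        (n : ℝ) * k * max 1 (3 * √2 * (∑ i, b i : ℕ) / (2 * (((∑ i, b i : ℕ) : ℝ) + 1))) ≤ T →
        Integrable
            (fun ω => cumulativeReward (cetcGreedyIS rule b T) (fun t => F t ω) T) μ ∧
          expectedRegret μ F (1 / 3) (cetcGreedyIS rule b T) T opt ≤
            C * (n : ℝ) ^ (1 / 3 : ℝ) * (k : ℝ) ^ (1 / 3 : ℝ) * (∑ i, b i : ℕ) *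
              (T : ℝ) ^ (2 / 3 : ℝ) * Real.log T ^ (1 / 3 : ℝ) := by
  refine ⟨12, by norm_num, ?_⟩
  intro n k b T rule Ω _ μ _ F opt hF hsub hmon hopt _ hT
  refine ⟨hF.integrable_cumulativeReward (isMeasurable_cetcGreedyIS rule b T) T, ?_⟩
  set B := ∑ i, b i with hB
  by_cases hN : n * k * B = 0
  -- Without queries `ε = 0` is admissible, and the whole bound is zero.
  · refine (expectedRegret_cetcGreedyIS_le hF hsub hmon hopt hB rfl rfl (by omega)
      le_rfl).trans ?_
    rw [hN]
    simp only [Nat.cast_zero, zero_mul, mul_zero, add_zero]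
    have := Real.log_natCast_nonneg T
    positivity
  · simp only [mul_eq_zero, not_or] at hN
    obtain ⟨⟨hn, hk⟩, hB0⟩ := hN
    have hn := Nat.pos_of_ne_zero hn
    have hk := Nat.pos_of_ne_zero hk
    have hB0 := Nat.pos_of_ne_zero hB0
    have hK : (1 : ℝ) ≤ (n : ℝ) * k := by exact_mod_cast Nat.mul_pos hn hk
    have hT1 : 1 < T := by exact_mod_cast one_lt_horizon hK (by exact_mod_cast hB0) hT
    have hKT : n * k ≤ T := by
      have := (le_mul_of_one_le_right (by linarith) (le_max_left _ _)).trans hT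
      exact_mod_cast this
    obtain ⟨hm, ε, hε, hbound⟩ := exists_accuracy hn hk hB0 hT1 hKT rfl
    exact (expectedRegret_cetcGreedyIS_le hF hsub hmon hopt hB rfl rfl (fun _ => hm) hε).trans
      hbound
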